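/- Let $\ell\mathbb{G}rp$ be the category of lattice-ordered groups (groups $X$, with neutral element $e$, equipped with a lattice order such that $x(y\vee z)=xy\vee xz$ and $(x\vee y)z=xz\vee yz$) and of group homomorphisms preserving $\vee$. For an object $X$, let $\mathrm{Eq}(X)$ be the poset of internal equivalence relations on $X$ (as subobjects of $X\times X$), and let $\mathrm{Ideals}(X)$ be the poset, under inclusion, of ideals of $X$, i.e. of kernels of morphisms with domain $X$. For $R\in\mathrm{Eq}(X)$ put $I_R=\{x\in X : (x,e)\in R\}$, and for a subset $S\subseteq X$ let $S^\perp=\{x\in X : |x|\wedge|s|=e\text{ for all }s\in S\}$ be its polar, where $|x|=x\vee x^{-1}$. Two internal equivalence relations $(R,r_1,r_2)$ and $(S,s_1,s_2)$ on $X$, with reflexivity morphisms $\delta_R,\delta_S$, commute in the Smith–Pedicchio sense, written $[R,S]=0$, if there is a unique morphism $p\colon R\times_X S\to X$, defined on the pullback of $r_2$ along $s_1$, such that $p\,(\mathrm{id}_R,\delta_S r_2)=r_1$ and $p\,(\delta_R s_1,\mathrm{id}_S)=s_2$. The centralizer of $R$ is the greatest internal equivalence relation on $X$ that commutes with $R$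 in this sense. Two subobjects $a\colon A\rightarrowtail X$ and $b\colon B\rightarrowtail X$ commute in the Huq sense, written $[a,b]=0$, if there is a morphism $\psi\colon A\times B\to X$ with $\psi\,(\mathrm{id}_A,0)=a$ and $\psi\,(0,\mathrm{id}_B)=b$. Then, for every lattice-ordered group $X$: 1. the assignment $\varphi(R)=I_R$ is an isomorphism of posets $\varphi\colon \mathrm{Eq}(X)\to\mathrm{Ideals}(X)$; 2. for all internal equivalence relations $R,S$ on $X$ one has $[R,S]=0$ if and only if $[I_R,I_S]=0$ in the Huq sense; 3. for every internal equivalence relation $R$ on $X$, the polar $I_R^\perp$ is an ideal of $X$, the centralizer of $R$ exists, and it is $\varphi^{-1}(I_R^\perp)$. -/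

import Mathlib

open CategoryTheory CategoryTheory.Limits

universe u v w

attribute [-instance] CategoryTheory.catToReflQuiver

/-! ### The category of lattice-ordered groups -/

/-- Homomorphisms of lattice-ordered groups: group homomorphisms preserving binary joins
(meets are then preserved automatically). -/
structure LGrpHom (A : Type u) (B : Type v) [Group A] [Lattice A] [Group B] [Lattice B]
    extends A →* B, SupHom A B

namespace LGrpHom

variable {A : Type u} {B : Type v} {D : Type w} [Group A] [Lattice A] [Group B] [Lattice B]
  [Group D] [Lattice D]

instance : FunLike (LGrpHom A B) A B where
  coe f := f.toFun
  coe_injective f g h := by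
    obtain ⟨⟨⟨f, _⟩, _⟩, _⟩ := f
    obtain ⟨⟨⟨g, _⟩, _⟩, _⟩ := g
    have : f = g := h
    subst this
    rfl

/-- The identity homomorphism. -/
protected def id (A : Type u) [Group A] [Lattice A] : LGrpHom A A :=
  { MonoidHom.id A with map_sup' := fun _ _ => rfl }

/-- Composition of homomorphisms. -/
protected def comp (g : LGrpHom B D) (f : LGrpHom A B) : LGrpHom A D :=
  { g.toMonoidHom.comp f.toMonoidHom with
    map_sup' := fun x y => (congrArg g.toFun (f.map_sup' x y)).trans (g.map_sup' _ _) }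

instance : MonoidHomClass (LGrpHom A B) A B where
  map_mul f := f.map_mul'
  map_one f := f.map_one'

instance : SupHomClass (LGrpHom A B) A B where
  map_sup f := f.map_sup'

/-- The trivial homomorphism, constant with value the neutral element. -/
def trivial (A : Type u) (B : Type v) [Group A] [Lattice A] [Group B] [Lattice B] :
    LGrpHom A B :=
  { (1 : A →* B) with map_sup' := fun _ _ => (sup_idem (1 : B)).symm }

end LGrpHom

/-- Lattice-ordered groups (not necessarily commutative): groups with a lattice structure such that
left and right translations are monotone, equivalently, such that the product distributes over
joins on both sides. -/
structure LGrp : Type (u + 1) where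
  /-- The underlying type. -/
  carrier : Type u
  [group : Group carrier]
  [lattice : Lattice carrier]
  [mulLeftMono : MulLeftMono carrier]
  [mulRightMono : MulRightMono carrier]

attribute [instance] LGrp.group LGrp.lattice LGrp.mulLeftMono LGrp.mulRightMono

namespace LGrp

instance : CoeSort LGrp.{u} (Type u) := ⟨LGrp.carrier⟩

/-- Morphisms of lattice-ordered groups. -/
@[ext]
structure Hom (X Y : LGrp.{u}) where
  /-- The underlying homomorphism. -/
  hom : LGrpHom X Y

instance : Category LGrp.{u} where
  Hom X Y := Hom X Y
  id X := ⟨LGrpHom.id X⟩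
  comp f g := ⟨g.hom.comp f.hom⟩

instance : ConcreteCategory LGrp.{u} (fun X Y => LGrpHom X Y) where
  hom f := f.hom
  ofHom f := ⟨f⟩

instance : HasZeroMorphisms LGrp.{u} where
  zero X Y := ⟨⟨LGrpHom.trivial X Y⟩⟩
  comp_zero _ _ := rfl
  zero_comp _ _ _ f := Hom.ext (DFunLike.ext _ _ fun _ => f.hom.map_one')

end LGrp

/-! ### Internal equivalence relations and their Smith-Pedicchio commutativity -/

section Internal

variable {C : Type u} [Category.{v} C]

/-- An internal equivalence relation `(R, r₁, r₂)` on an object `X`; `rel.r` is its reflexivity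
morphism `δ : X ⟶ R`. -/
structure InternalEqRel (X : C) where
  /-- The object `R`. -/
  obj : C
  /-- The first projection `r₁`. -/
  fst : obj ⟶ X
  /-- The second projection `r₂`. -/
  snd : obj ⟶ X
  /-- `(r₁, r₂)` is jointly monic, reflexive, symmetric and transitive. -/
  rel : EquivalenceRelation fst snd

namespace InternalEqRel

variable {X : C}

/-- Internal equivalence relations are (pre)ordered as subobjects of `X × X`. -/
instance : Preorder (InternalEqRel X) where
  le R S := ∃ f : R.obj ⟶ S.obj, f ≫ S.fst = R.fst ∧ f ≫ S.snd = R.snd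
  le_refl R := ⟨𝟙 _, Category.id_comp _, Category.id_comp _⟩
  le_trans := by
    rintro R S T ⟨f, hf₁, hf₂⟩ ⟨g, hg₁, hg₂⟩
    exact ⟨f ≫ g, by rw [Category.assoc, hg₁, hf₁], by rw [Category.assoc, hg₂, hf₂]⟩

/-- `R` and `S` commute in the Smith-Pedicchio sense: on the pullback `P = R ×_X S` of `r₂` along
`s₁` there is a unique morphism `p : P ⟶ X` (the connector) with `p ∘ (id, δ_S r₂) = r₁` and
`p ∘ (δ_R s₁, id) = s₂`. -/
def SmithCommute (R S : InternalEqRel X) : Prop :=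
  ∃ (P : C) (πR : P ⟶ R.obj) (πS : P ⟶ S.obj) (h : IsPullback πR πS R.snd S.fst),
    ∃! p : P ⟶ X,
      h.lift (𝟙 R.obj) (R.snd ≫ S.rel.r) (by simp) ≫ p = R.fst ∧
      h.lift (S.fst ≫ R.rel.r) (𝟙 S.obj) (by simp) ≫ p = S.snd

/-- `Z` is a centralizer of `R`: it is greatest among the internal equivalence relations that
commute with `R` in the Smith-Pedicchio sense. -/
def IsCentralizer (R Z : InternalEqRel X) : Prop :=
  IsGreatest {S : InternalEqRel X | R.SmithCommute S} Z

end InternalEqRel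

/-- The partially ordered set `Eq(X)` of internal equivalence relations on `X`, where
relations that are isomorphic over `X × X` are identified. -/
abbrev EqPoset (X : C) := Antisymmetrization (InternalEqRel X) (· ≤ ·)

/-- The element of `Eq(X)` represented by an internal equivalence relation. -/
abbrev InternalEqRel.toEq {X : C} (R : InternalEqRel X) : EqPoset X :=
  toAntisymmetrization (· ≤ ·) R

/-- `a : A ⟶ X` and `b : B ⟶ X` commute in the sense of Huq: there is a cooperator
`φ : A × B ⟶ X` with `φ ∘ (id, 0) = a` and `φ ∘ (0, id) = b`. -/
def HuqCommute [HasZeroMorphisms C] {A B X : C} (a : A ⟶ X) (b : B ⟶ X) : Prop :=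
  ∃ (c : BinaryFan A B) (hc : IsLimit c) (φ : c.pt ⟶ X),
    hc.lift (BinaryFan.mk (𝟙 A) 0) ≫ φ = a ∧ hc.lift (BinaryFan.mk 0 (𝟙 B)) ≫ φ = b

end Internal

/-! ### Ideals and polars in lattice-ordered groups -/

namespace LGrp

/-- Subalgebras of a lattice-ordered group: subgroups closed under joins. -/
structure Subalg (X : LGrp.{u}) extends Subgroup X where
  sup_mem' : ∀ {x y : X}, x ∈ carrier → y ∈ carrier → x ⊔ y ∈ carrier

namespace Subalg

variable {X : LGrp.{u}} (A : Subalg X)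

/-- The lattice structure on a subalgebra, with the operations of `X`. -/
instance : Lattice A.toSubgroup :=
  Subtype.lattice (fun {_ _} hx hy => A.sup_mem' hx hy) (fun {x y} hx hy => by
    have h : x ⊓ y = (x⁻¹ ⊔ y⁻¹)⁻¹ := by rw [inv_sup, inv_inv, inv_inv]
    rw [h]
    exact A.inv_mem' (A.sup_mem' (A.inv_mem' hx) (A.inv_mem' hy)))

/-- A subalgebra as a lattice-ordered group. -/
def toLGrp : LGrp.{u} where
  carrier := A.toSubgroup
  mulLeftMono := ⟨fun a _ _ h => mul_le_mul_right (α := X) h a⟩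
  mulRightMono := ⟨fun a _ _ h => mul_le_mul_left (α := X) h a⟩

/-- The inclusion of a subalgebra. -/
def incl : A.toLGrp ⟶ X :=
  ⟨{ A.toSubgroup.subtype with map_sup' := fun _ _ => rfl }⟩

end Subalg

/-- A subset of a lattice-ordered group is an ideal if it is the kernel of some morphism. -/
def IsIdeal {X : LGrp.{u}} (I : Set X) : Prop :=
  ∃ (Y : LGrp.{u}) (f : X ⟶ Y), I = {x : X | f x = 1}

/-- The set of ideals of `X`, ordered by inclusion. -/
abbrev Ideals (X : LGrp.{u}) := {I : Set X // IsIdeal I}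

/-- The ideal `I_R = {x | (x, e) ∈ R}` of an internal equivalence relation `R`. -/
def idealOf {X : LGrp.{u}} (R : InternalEqRel X) : Subalg X where
  carrier := {x : X | ∃ r : R.obj, R.fst r = x ∧ R.snd r = 1}
  one_mem' := ⟨1, map_one R.fst.hom, map_one R.snd.hom⟩
  mul_mem' := by
    rintro _ _ ⟨r, rfl, hr⟩ ⟨s, rfl, hs⟩
    exact ⟨r * s, map_mul R.fst.hom r s,
      (map_mul R.snd.hom r s).trans ((congrArg₂ (· * ·) hr hs).trans (mul_one 1))⟩
  inv_mem' := by
    rintro _ ⟨r, rfl, hr⟩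
    exact ⟨r⁻¹, map_inv R.fst.hom r,
      (map_inv R.snd.hom r).trans ((congrArg (·⁻¹) hr).trans inv_one)⟩
  sup_mem' := by
    rintro _ _ ⟨r, rfl, hr⟩ ⟨s, rfl, hs⟩
    exact ⟨r ⊔ s, map_sup R.fst.hom r s,
      (map_sup R.snd.hom r s).trans ((congrArg₂ (· ⊔ ·) hr hs).trans (sup_idem 1))⟩

/-- The underlying set of `I_R`. -/
def idealSet {X : LGrp.{u}} (R : InternalEqRel X) : Set X := (idealOf R).toSubgroup

/-- The polar `S^⊥ = {x | |x| ∧ |s| = e for all s ∈ S}`, where `|x| = x ∨ x⁻¹`. -/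
def polar {X : LGrp.{u}} (S : Set X) : Set X := {x : X | ∀ s ∈ S, mabs x ⊓ mabs s = 1}

end LGrp

/-! A relation `R` is determined by its class of `e`: (a, b) = (ab⁻¹, e)(b, b) and `R` contains the
diagonal, so `R ≤ S` amounts to I_R ⊆ I_S (`le_iff_idealSet_subset`). Kernel pairs realise every
ideal.

Both kinds of commutation say that I_R and I_S meet trivially. A connector restricts to a
cooperator. A cooperator forces |a| ∧ |b| = e, since (|a|, e) ∧ (e, |b|) = (e, e) in the product; so
a common element x has |x| = |x| ∧ |x| = e. Conversely, if the intersection is trivial, X embeds in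
X/I_R × X/I_S, and r₁r₂⁻¹s₂ is a morphism because it becomes s₂ in one quotient and r₁ in the other
(`smithCommute_of_disjoint`).

Hence `R` and `S` commute exactly when I_S ⊆ I_R^⊥. This polar is an ideal (`isIdeal_polar`), so the
relation it determines is the centralizer. -/

namespace LGrp

/-! ### Morphisms on elements -/

section Elements

variable {X Y Z : LGrp.{u}}

@[ext]
theorem hom_ext {f g : X ⟶ Y} (h : ∀ x, f x = g x) : f = g :=
  Hom.ext (DFunLike.ext _ _ h)

theorem comp_apply' (f : X ⟶ Y) (g : Y ⟶ Z) (x : X) : (f ≫ g) x = g (f x) := rfl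

theorem hom_one (f : X ⟶ Y) : f 1 = 1 := map_one f.hom

theorem hom_mul (f : X ⟶ Y) (x y : X) : f (x * y) = f x * f y := map_mul f.hom x y

theorem hom_inv (f : X ⟶ Y) (x : X) : f x⁻¹ = (f x)⁻¹ := map_inv f.hom x

theorem hom_sup (f : X ⟶ Y) (x y : X) : f (x ⊔ y) = f x ⊔ f y := map_sup f.hom x y

theorem hom_inf (f : X ⟶ Y) (x y : X) : f (x ⊓ y) = f x ⊓ f y := by
  have h : ∀ {W : LGrp.{u}} (a b : W), a ⊓ b = (a⁻¹ ⊔ b⁻¹)⁻¹ := fun a b => by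
    rw [inv_sup, inv_inv, inv_inv]
  rw [h, h, hom_inv, hom_sup, hom_inv, hom_inv]

theorem hom_mabs (f : X ⟶ Y) (x : X) : f (mabs x) = mabs (f x) := by
  rw [mabs, mabs, hom_sup, hom_inv]

/-- A morphism of lattice-ordered groups from a map preserving products and joins. -/
def mkHom (f : X → Y) (hmul : ∀ x y, f (x * y) = f x * f y)
    (hsup : ∀ x y, f (x ⊔ y) = f x ⊔ f y) : X ⟶ Y :=
  ⟨{ MonoidHom.mk' f hmul with map_sup' := hsup }⟩

/-- Elements are separated by a jointly monic pair of morphisms. -/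
theorem ext_of_jointlyMono (f : X ⟶ Y) (g : X ⟶ Z)
    (h : ∀ ⦃W : LGrp.{u}⦄ (a b : W ⟶ X), a ≫ f = b ≫ f → a ≫ g = b ≫ g → a = b)
    {x y : X} (hf : f x = f y) (hg : g x = g y) : x = y := by
  let K : Subalg X :=
    { carrier := {k | f k = 1 ∧ g k = 1}
      one_mem' := ⟨hom_one f, hom_one g⟩
      mul_mem' := fun {a b} ha hb => by
        simp only [Set.mem_ofPred_eq] at ha hb ⊢
        simp [hom_mul, ha, hb]
      inv_mem' := fun {a} ha => by
        simp only [Set.mem_ofPred_eq] at ha ⊢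
        simp [hom_inv, ha]
      sup_mem' := fun {a b} ha hb => by
        simp only [Set.mem_ofPred_eq] at ha hb ⊢
        simp [ha, hb] }
  -- Joint monicity is tested on the common kernel `K`, where the inclusion and the zero morphism
  -- agree after `f` and after `g`.
  have hK : K.incl = 0 := h _ _
    (by ext k; exact k.2.1.trans (hom_one f).symm) (by ext k; exact k.2.2.trans (hom_one g).symm)
  have hxy : x * y⁻¹ ∈ K.toSubgroup :=
    ⟨by rw [hom_mul, hom_inv, hf, mul_inv_cancel], by rw [hom_mul, hom_inv, hg, mul_inv_cancel]⟩
  have : K.incl ⟨x * y⁻¹, hxy⟩ = 1 := by rw [hK]; rfl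
  exact mul_inv_eq_one.1 this

end Elements

/-! ### Pullbacks and products -/

section Limits

variable {X Y Z : LGrp.{u}}

/-- The product of two lattice-ordered groups. -/
def prod (X Y : LGrp.{u}) : LGrp.{u} where
  carrier := X × Y
  mulLeftMono := ⟨fun a _ _ h =>
    Prod.mk_le_mk.2 ⟨mul_le_mul_right h.1 a.1, mul_le_mul_right h.2 a.2⟩⟩
  mulRightMono := ⟨fun a _ _ h =>
    Prod.mk_le_mk.2 ⟨mul_le_mul_left h.1 a.1, mul_le_mul_left h.2 a.2⟩⟩

/-- The fibre product of two morphisms, as a subalgebra of the product. -/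
def fiberProduct (f : X ⟶ Z) (g : Y ⟶ Z) : Subalg (prod X Y) where
  carrier := {q : X × Y | f q.1 = g q.2}
  one_mem' := (hom_one f).trans (hom_one g).symm
  mul_mem' := fun {a b} (ha : f a.1 = g a.2) (hb : f b.1 = g b.2) => by
    change f (a.1 * b.1) = g (a.2 * b.2)
    rw [hom_mul, hom_mul, ha, hb]
  inv_mem' := fun {a} (ha : f a.1 = g a.2) => by
    change f a.1⁻¹ = g a.2⁻¹
    rw [hom_inv, hom_inv, ha]
  sup_mem' := fun {a b} (ha : f a.1 = g a.2) (hb : f b.1 = g b.2) => by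
    change f (a.1 ⊔ b.1) = g (a.2 ⊔ b.2)
    rw [hom_sup, hom_sup, ha, hb]

/-- The first projection of the fibre product. -/
def fiberFst (f : X ⟶ Z) (g : Y ⟶ Z) : (fiberProduct f g).toLGrp ⟶ X :=
  mkHom (fun q => q.1.1) (fun _ _ => rfl) fun _ _ => rfl

/-- The second projection of the fibre product. -/
def fiberSnd (f : X ⟶ Z) (g : Y ⟶ Z) : (fiberProduct f g).toLGrp ⟶ Y :=
  mkHom (fun q => q.1.2) (fun _ _ => rfl) fun _ _ => rfl

theorem fiberProduct_ext {f : X ⟶ Z} {g : Y ⟶ Z} {p q : (fiberProduct f g).toLGrp}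
    (h₁ : fiberFst f g p = fiberFst f g q) (h₂ : fiberSnd f g p = fiberSnd f g q) : p = q :=
  Subtype.ext (Prod.ext h₁ h₂)

theorem isPullback_fiberProduct (f : X ⟶ Z) (g : Y ⟶ Z) :
    IsPullback (fiberFst f g) (fiberSnd f g) f g where
  w := by ext q; exact q.2
  isLimit' := ⟨PullbackCone.IsLimit.mk _
    (fun s => mkHom (Y := (fiberProduct f g).toLGrp)
      (fun x => ⟨(s.fst x, s.snd x), congrArg (fun k : s.pt ⟶ Z => k x) s.condition⟩)
      (fun x y => fiberProduct_ext (hom_mul s.fst x y) (hom_mul s.snd x y))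
      (fun x y => fiberProduct_ext (hom_sup s.fst x y) (hom_sup s.snd x y)))
    (fun _ => rfl) (fun _ => rfl)
    (fun s m h₁ h₂ => by
      ext x
      exact fiberProduct_ext (congrArg (fun k : s.pt ⟶ X => k x) h₁)
        (congrArg (fun k : s.pt ⟶ Y => k x) h₂))⟩

/-- The product fan. -/
def prodFan (X Y : LGrp.{u}) : BinaryFan X Y :=
  BinaryFan.mk (P := prod X Y) (mkHom Prod.fst (fun _ _ => rfl) fun _ _ => rfl)
    (mkHom Prod.snd (fun _ _ => rfl) fun _ _ => rfl)

/-- The product fan is limiting. -/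
def prodFanIsLimit (X Y : LGrp.{u}) : IsLimit (prodFan X Y) :=
  BinaryFan.IsLimit.mk _
    (fun {T} f g => mkHom (X := T) (Y := prod X Y) (fun x => (f x, g x))
      (fun x y => Prod.ext (hom_mul f x y) (hom_mul g x y))
      (fun x y => Prod.ext (hom_sup f x y) (hom_sup g x y)))
    (fun _ _ => rfl) (fun _ _ => rfl)
    (fun {T} f g m h₁ h₂ => by
      ext x
      exact Prod.ext (congrArg (fun k : T ⟶ X => k x) h₁) (congrArg (fun k : T ⟶ Y => k x) h₂))

end Limits

/-! ### Quotients by ideals -/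

section Quotients

variable {X : LGrp.{u}}

/-- A normal subgroup whose cosets are compatible with joins is an ideal. -/
theorem isIdeal_of_normal (N : Subgroup X) [N.Normal]
    (h : ∀ x y z : X, x⁻¹ * y ∈ N → (x ⊔ z)⁻¹ * (y ⊔ z) ∈ N) : IsIdeal (N : Set X) := by
  have hsup : ∀ x x' y y' : X, x⁻¹ * x' ∈ N → y⁻¹ * y' ∈ N →
      (x ⊔ y)⁻¹ * (x' ⊔ y') ∈ N := fun x x' y y' hx hy => by
    have h₁ := h x x' y hx
    have h₂ := h y y' x' hy
    rw [sup_comm y, sup_comm y'] at h₂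
    simpa [mul_assoc] using N.mul_mem h₁ h₂
  have hinv : ∀ x x' : X, x⁻¹ * x' ∈ N → x⁻¹⁻¹ * x'⁻¹ ∈ N := fun x x' hx => by
    have := N.inv_mem (‹N.Normal›.conj_mem _ hx x)
    simpa [mul_assoc] using this
  have hinf : ∀ x x' y y' : X, x⁻¹ * x' ∈ N → y⁻¹ * y' ∈ N →
      (x ⊓ y)⁻¹ * (x' ⊓ y') ∈ N := fun x x' y y' hx hy => by
    have := hinv _ _ (hsup _ _ _ _ (hinv _ _ hx) (hinv _ _ hy))
    simpa only [inv_sup, inv_inv] using this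
  let _ : Max (X ⧸ N) := ⟨Quotient.map₂ (· ⊔ ·) fun x x' hx y y' hy =>
    QuotientGroup.leftRel_apply.2
      (hsup x x' y y' (QuotientGroup.leftRel_apply.1 hx) (QuotientGroup.leftRel_apply.1 hy))⟩
  let _ : Min (X ⧸ N) := ⟨Quotient.map₂ (· ⊓ ·) fun x x' hx y y' hy =>
    QuotientGroup.leftRel_apply.2
      (hinf x x' y y' (QuotientGroup.leftRel_apply.1 hx) (QuotientGroup.leftRel_apply.1 hy))⟩
  let _ : Lattice (X ⧸ N) := Lattice.mk'
    (by rintro ⟨a⟩ ⟨b⟩; exact congrArg _ (sup_comm a b))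
    (by rintro ⟨a⟩ ⟨b⟩ ⟨c⟩; exact congrArg _ (sup_assoc a b c))
    (by rintro ⟨a⟩ ⟨b⟩; exact congrArg _ (inf_comm a b))
    (by rintro ⟨a⟩ ⟨b⟩ ⟨c⟩; exact congrArg _ (inf_assoc a b c))
    (by rintro ⟨a⟩ ⟨b⟩; exact congrArg _ (sup_inf_self (a := a) (b := b)))
    (by rintro ⟨a⟩ ⟨b⟩; exact congrArg _ (inf_sup_self (a := a) (b := b)))
  -- `Lattice.mk'` defines the order by this equation, so monotonicity of translations follows from
  -- distributivity over joins in `X`.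
  have hle : ∀ a b : X ⧸ N, a ≤ b ↔ a ⊔ b = b := fun _ _ => Iff.rfl
  let Q : LGrp.{u} :=
    { carrier := X ⧸ N
      mulLeftMono := ⟨by
        rintro ⟨a⟩ ⟨b⟩ ⟨c⟩ hbc
        refine (hle _ _).2 (Eq.trans ?_ (congrArg ((a : X ⧸ N) * ·) ((hle _ _).1 hbc)))
        exact (congrArg (QuotientGroup.mk (s := N)) (mul_sup b c a)).symm⟩
      mulRightMono := ⟨by
        rintro ⟨a⟩ ⟨b⟩ ⟨c⟩ hbc
        refine (hle _ _).2 (Eq.trans ?_ (congrArg (· * (a : X ⧸ N)) ((hle _ _).1 hbc)))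
        exact (congrArg (QuotientGroup.mk (s := N)) (sup_mul b c a)).symm⟩ }
  refine ⟨Q, mkHom (Y := Q) (QuotientGroup.mk (s := N)) (fun _ _ => rfl) (fun _ _ => rfl), ?_⟩
  ext x
  exact (QuotientGroup.eq_one_iff x).symm

end Quotients

/-! ### Polars as ideals -/

section Polars

variable {X : LGrp.{u}}

/-- Since s ≤ us, the meet lies below uv ∧ us = u(v ∧ s) = u, hence below u ∧ s. -/
theorem inf_mul_eq_one {u v s : X} (hu : 1 ≤ u) (hv : 1 ≤ v) (hs : 1 ≤ s)
    (hus : u ⊓ s = 1) (hvs : v ⊓ s = 1) : u * v ⊓ s = 1 := by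
  refine le_antisymm ?_ (le_inf (one_le_mul hu hv) hs)
  rw [← hus]
  refine le_inf ?_ inf_le_right
  calc u * v ⊓ s ≤ u * v ⊓ u * s := inf_le_inf_left _ (le_mul_of_one_le_left' hu)
    _ = u := by rw [← mul_inf, hvs, mul_one]

/-- Without commutativity |x||y| need not bound (xy)⁻¹ = y⁻¹x⁻¹; the second factor |x| makes room
for it. -/
theorem mabs_mul_le_mul_mul (x y : X) : mabs (x * y) ≤ mabs x * mabs y * mabs x := by
  have hx := one_le_mabs x
  refine mabs_le'.2 ⟨?_, ?_⟩
  · exact (mul_le_mul' (le_mabs_self x) (le_mabs_self y)).trans (le_mul_of_one_le_right' hx)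
  · rw [mul_inv_rev]
    refine (mul_le_mul' (inv_le_mabs y) (inv_le_mabs x)).trans ?_
    rw [mul_assoc]
    exact le_mul_of_one_le_left' hx

theorem mabs_conj (g x : X) : mabs (g * x * g⁻¹) = g * mabs x * g⁻¹ := by
  rw [mabs, mabs, mul_sup, sup_mul]
  group

theorem mem_polar_of_mabs_le {S : Set X} {x y : X} (hy : y ∈ polar S) (h : mabs x ≤ mabs y) :
    x ∈ polar S := fun s hs =>
  le_antisymm ((inf_le_inf_right _ h).trans (hy s hs).le) (le_inf (one_le_mabs x) (one_le_mabs s))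

theorem mul_mem_polar {S : Set X} {x y : X} (hx : x ∈ polar S) (hy : y ∈ polar S) :
    x * y ∈ polar S := fun s hs => by
  have hxy : (mabs x * mabs y * mabs x) ⊓ mabs s = 1 :=
    inf_mul_eq_one (one_le_mul (one_le_mabs x) (one_le_mabs y)) (one_le_mabs x) (one_le_mabs s)
      (inf_mul_eq_one (one_le_mabs x) (one_le_mabs y) (one_le_mabs s) (hx s hs) (hy s hs))
      (hx s hs)
  exact le_antisymm ((inf_le_inf_right _ (mabs_mul_le_mul_mul x y)).trans hxy.le)
    (le_inf (one_le_mabs _) (one_le_mabs s))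

/-- If b ≤ ad and e ≤ d, then also z ≤ zd, so b ∨ z ≤ (a ∨ z)d. This is used with d = |x⁻¹y| for
both orders of x and y. -/
theorem mabs_inv_sup_mul_sup_le (x y z : X) : mabs ((x ⊔ z)⁻¹ * (y ⊔ z)) ≤ mabs (x⁻¹ * y) := by
  have key : ∀ a b d : X, 1 ≤ d → a⁻¹ * b ≤ d → (a ⊔ z)⁻¹ * (b ⊔ z) ≤ d := fun a b d hd h => by
    rw [inv_mul_le_iff_le_mul, sup_mul] at *
    exact sup_le_sup h (le_mul_of_one_le_right' hd)
  refine mabs_le'.2 ⟨key _ _ _ (one_le_mabs _) (le_mabs_self _), ?_⟩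
  rw [mul_inv_rev, inv_inv]
  refine key _ _ _ (one_le_mabs _) ?_
  simpa using inv_le_mabs (x⁻¹ * y)

/-- The polar of a set that is stable under conjugation is an ideal. -/
theorem isIdeal_polar {S : Set X} (hS : ∀ g, ∀ s ∈ S, g * s * g⁻¹ ∈ S) : IsIdeal (polar S) := by
  let N : Subgroup X :=
    { carrier := polar S
      one_mem' := fun s _ => by rw [mabs_one]; exact inf_eq_left.2 (one_le_mabs s)
      mul_mem' := mul_mem_polar
      inv_mem' := fun {x} hx s hs => by rw [mabs_inv]; exact hx s hs }
  have : N.Normal := ⟨fun x hx g s hs => by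
    -- Orthogonality of gxg⁻¹ to s is that of x to g⁻¹sg, conjugated by g.
    have h := hx _ (hS g⁻¹ s hs)
    rw [mabs_conj] at h
    rw [mabs_conj]
    calc g * mabs x * g⁻¹ ⊓ mabs s = g * (mabs x ⊓ g⁻¹ * mabs s * g⁻¹⁻¹) * g⁻¹ := by
          rw [mul_inf, inf_mul]; group
      _ = 1 := by rw [h]; group⟩
  exact isIdeal_of_normal N fun x y z h =>
    mem_polar_of_mabs_le (S := S) h (mabs_inv_sup_mul_sup_le x y z)

end Polars

/-! ### Equivalence relations and ideals -/

section EquivalenceRelations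

variable {X : LGrp.{u}} (R S : InternalEqRel X)

theorem fst_refl (x : X) : R.fst (R.rel.r x) = x :=
  congrArg (fun k : X ⟶ X => k x) R.rel.reflexivity₁

theorem snd_refl (x : X) : R.snd (R.rel.r x) = x :=
  congrArg (fun k : X ⟶ X => k x) R.rel.reflexivity₂

variable {R} in
theorem eqRel_ext {r s : R.obj} (h₁ : R.fst r = R.fst s) (h₂ : R.snd r = R.snd s) : r = s :=
  ext_of_jointlyMono R.fst R.snd R.rel.right_cancellation h₁ h₂

theorem idealSet_conj (g x : X) (hx : x ∈ idealSet R) : g * x * g⁻¹ ∈ idealSet R := by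
  obtain ⟨r, rfl, hr⟩ := hx
  refine ⟨R.rel.r g * r * (R.rel.r g)⁻¹, ?_, ?_⟩
  · rw [hom_mul, hom_mul, hom_inv, fst_refl]
  · rw [hom_mul, hom_mul, hom_inv, snd_refl, hr, mul_one, mul_inv_cancel]

theorem isIdeal_idealSet : IsIdeal (idealSet R) := by
  have : (idealOf R).toSubgroup.Normal := ⟨fun x hx g => idealSet_conj R g x hx⟩
  refine isIdeal_of_normal (idealOf R).toSubgroup fun x y z => ?_
  rintro ⟨r, h₁, h₂⟩
  -- As `r` is the pair (x⁻¹y, e), the product (x, x)r is (y, x); joining with (z, z) gives (y ∨ z,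
  -- x ∨ z), which is then translated by a diagonal pair.
  refine ⟨(R.rel.r (x ⊔ z))⁻¹ * (R.rel.r x * r ⊔ R.rel.r z), ?_, ?_⟩
  · rw [hom_mul, hom_inv, fst_refl, hom_sup, hom_mul, fst_refl, fst_refl, h₁, mul_inv_cancel_left]
  · rw [hom_mul, hom_inv, snd_refl, hom_sup, hom_mul, snd_refl, snd_refl, h₂, mul_one,
      inv_mul_cancel]

theorem fst_mul_inv_snd_mem (r : R.obj) : R.fst r * (R.snd r)⁻¹ ∈ idealSet R :=
  ⟨r * (R.rel.r (R.snd r))⁻¹, by rw [hom_mul, hom_inv, fst_refl],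
    by rw [hom_mul, hom_inv, snd_refl, mul_inv_cancel]⟩

variable {R S}

theorem le_iff_idealSet_subset : R ≤ S ↔ idealSet R ⊆ idealSet S := by
  constructor
  · rintro ⟨f, hf₁, hf₂⟩ _ ⟨r, rfl, hr⟩
    refine ⟨f r, congrArg (fun k : R.obj ⟶ X => k r) hf₁, ?_⟩
    exact (congrArg (fun k : R.obj ⟶ X => k r) hf₂).trans hr
  · intro h
    have hex : ∀ r : R.obj, ∃ s : S.obj, S.fst s = R.fst r ∧ S.snd s = R.snd r := fun r => by
      obtain ⟨s, h₁, h₂⟩ := h (fst_mul_inv_snd_mem R r)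
      refine ⟨s * S.rel.r (R.snd r), ?_, ?_⟩
      · rw [hom_mul, h₁, fst_refl, inv_mul_cancel_right]
      · rw [hom_mul, h₂, snd_refl, one_mul]
    choose f hf₁ hf₂ using hex
    refine ⟨mkHom f (fun x y => eqRel_ext ?_ ?_) (fun x y => eqRel_ext ?_ ?_), ?_, ?_⟩
    · rw [hf₁, hom_mul, hom_mul, hf₁, hf₁]
    · rw [hf₂, hom_mul, hom_mul, hf₂, hf₂]
    · rw [hf₁, hom_sup, hom_sup, hf₁, hf₁]
    · rw [hf₂, hom_sup, hom_sup, hf₂, hf₂]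
    · ext r; exact hf₁ r
    · ext r; exact hf₂ r

theorem exists_idealSet_eq {I : Set X} (hI : IsIdeal I) :
    ∃ R : InternalEqRel X, idealSet R = I := by
  obtain ⟨Y, f, rfl⟩ := hI
  refine ⟨⟨_, fiberFst f f, fiberSnd f f, IsKernelPair.equivalenceRelation f _ _
    (isPullback_fiberProduct (fiberSnd f f) (fiberFst f f)).isLimit
    (isPullback_fiberProduct f f)⟩, ?_⟩
  ext x
  constructor
  · rintro ⟨⟨⟨a, b⟩, h⟩, rfl, hb⟩
    have hb : b = 1 := hb
    subst hb
    exact Eq.trans h (hom_one f)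
  · intro hx
    exact ⟨⟨(x, 1), Eq.trans hx (hom_one f).symm⟩, rfl, rfl⟩

/-- The isomorphism between internal equivalence relations and ideals. -/
noncomputable def eqOrderIso (X : LGrp.{u}) : EqPoset X ≃o Ideals X :=
  RelIso.ofSurjective
    (OrderEmbedding.ofMapLEIff
      (Quotient.lift (fun R : InternalEqRel X => (⟨idealSet R, isIdeal_idealSet R⟩ : Ideals X))
        fun _ _ h => le_antisymm (le_iff_idealSet_subset.1 h.1) (le_iff_idealSet_subset.1 h.2))
      (by rintro ⟨R⟩ ⟨S⟩; exact le_iff_idealSet_subset.symm))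
    (by
      rintro ⟨I, hI⟩
      obtain ⟨R, rfl⟩ := exists_idealSet_eq hI
      exact ⟨R.toEq, rfl⟩)

end EquivalenceRelations

/-! ### Commutation and centralizers -/

section Commutators

variable {X : LGrp.{u}} {R S : InternalEqRel X}

/-- An ideal inside its equivalence relation, as pairs with trivial second coordinate. -/
noncomputable def idealLeft (R : InternalEqRel X) : (idealOf R).toLGrp ⟶ R.obj :=
  mkHom (X := (idealOf R).toLGrp) (fun x => x.2.choose)
    (fun x y => eqRel_ext
      (by rw [hom_mul, x.2.choose_spec.1, y.2.choose_spec.1]; exact (x * y).2.choose_spec.1)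
      (by rw [hom_mul, x.2.choose_spec.2, y.2.choose_spec.2, mul_one]
          exact (x * y).2.choose_spec.2))
    (fun x y => eqRel_ext
      (by rw [hom_sup, x.2.choose_spec.1, y.2.choose_spec.1]; exact (x ⊔ y).2.choose_spec.1)
      (by rw [hom_sup, x.2.choose_spec.2, y.2.choose_spec.2, sup_idem]
          exact (x ⊔ y).2.choose_spec.2))

theorem idealLeft_fst : idealLeft R ≫ R.fst = (idealOf R).incl := by
  ext x; exact x.2.choose_spec.1

theorem idealLeft_snd : idealLeft R ≫ R.snd = 0 := by
  ext x; exact x.2.choose_spec.2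

/-- The cooperator sends (a, b) to the value of the connector at the pairs (a, e) in `R` and (e, b)
in `S`; symmetry of `S` supplies the second pair. -/
theorem SmithCommute.huqCommute (h : R.SmithCommute S) :
    HuqCommute (idealOf R).incl (idealOf S).incl := by
  obtain ⟨P, πR, πS, hP, p, ⟨hp₁, hp₂⟩, -⟩ := h
  let iS : (idealOf S).toLGrp ⟶ S.obj := idealLeft S ≫ S.rel.s
  have iS_fst : iS ≫ S.fst = 0 := by
    rw [Category.assoc, S.rel.symmetry₁, idealLeft_snd]
  have iS_snd : iS ≫ S.snd = (idealOf S).incl := by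
    rw [Category.assoc, S.rel.symmetry₂, idealLeft_fst]
  let π₁ : prod (idealOf R).toLGrp (idealOf S).toLGrp ⟶ (idealOf R).toLGrp := (prodFan _ _).fst
  let π₂ : prod (idealOf R).toLGrp (idealOf S).toLGrp ⟶ (idealOf S).toLGrp := (prodFan _ _).snd
  let k : prod (idealOf R).toLGrp (idealOf S).toLGrp ⟶ P :=
    hP.lift (π₁ ≫ idealLeft R) (π₂ ≫ iS) (by
      rw [Category.assoc, Category.assoc, idealLeft_snd, iS_fst, comp_zero, comp_zero])
  have hk₁ : k ≫ πR = π₁ ≫ idealLeft R := hP.lift_fst _ _ _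
  have hk₂ : k ≫ πS = π₂ ≫ iS := hP.lift_snd _ _ _
  have left : ∀ l : (idealOf R).toLGrp ⟶ prod (idealOf R).toLGrp (idealOf S).toLGrp,
      l ≫ π₁ = 𝟙 _ → l ≫ π₂ = 0 → l ≫ k ≫ p = (idealOf R).incl := fun l hl₁ hl₂ => by
    have : l ≫ k = idealLeft R ≫ hP.lift (𝟙 R.obj) (R.snd ≫ S.rel.r) (by simp) := by
      apply hP.hom_ext
      · rw [Category.assoc, hk₁, reassoc_of% hl₁, Category.assoc, hP.lift_fst, Category.comp_id]
      · rw [Category.assoc, hk₂, reassoc_of% hl₂, Category.assoc, hP.lift_snd,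
          reassoc_of% (idealLeft_snd (R := R)), zero_comp, zero_comp]
    rw [← Category.assoc, this, Category.assoc, hp₁, idealLeft_fst]
  have right : ∀ l : (idealOf S).toLGrp ⟶ prod (idealOf R).toLGrp (idealOf S).toLGrp,
      l ≫ π₁ = 0 → l ≫ π₂ = 𝟙 _ → l ≫ k ≫ p = (idealOf S).incl := fun l hl₁ hl₂ => by
    have : l ≫ k = iS ≫ hP.lift (S.fst ≫ R.rel.r) (𝟙 S.obj) (by simp) := by
      apply hP.hom_ext
      · rw [Category.assoc, hk₁, reassoc_of% hl₁, Category.assoc, hP.lift_fst,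
          reassoc_of% iS_fst, zero_comp, zero_comp]
      · rw [Category.assoc, hk₂, reassoc_of% hl₂, Category.assoc, hP.lift_snd, Category.comp_id]
    rw [← Category.assoc, this, Category.assoc, hp₂, iS_snd]
  exact ⟨prodFan _ _, prodFanIsLimit _ _, k ≫ p, left _ rfl rfl, right _ rfl rfl⟩

theorem eq_one_of_mabs_eq_one {x : X} (h : mabs x = 1) : x = 1 :=
  le_antisymm (h ▸ le_mabs_self x) (inv_le_one'.1 (h ▸ inv_le_mabs x))

/-- Subalgebras that commute in the sense of Huq are disjoint. -/
theorem HuqCommute.mabs_inf_mabs {A B : Subalg X} (h : HuqCommute A.incl B.incl) {a b : X}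
    (ha : a ∈ A.toSubgroup) (hb : b ∈ B.toSubgroup) : mabs a ⊓ mabs b = 1 := by
  obtain ⟨F, hF, φ, h₁, h₂⟩ := h
  let a' : A.toLGrp := (⟨a, ha⟩ : A.toSubgroup)
  let b' : B.toLGrp := (⟨b, hb⟩ : B.toSubgroup)
  set l := hF.lift (BinaryFan.mk (𝟙 A.toLGrp) (0 : _ ⟶ B.toLGrp))
  set m := hF.lift (BinaryFan.mk (0 : _ ⟶ A.toLGrp) (𝟙 B.toLGrp))
  have hl₁ : l ≫ F.fst = 𝟙 _ := hF.fac _ ⟨WalkingPair.left⟩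
  have hl₂ : l ≫ F.snd = 0 := hF.fac _ ⟨WalkingPair.right⟩
  have hm₁ : m ≫ F.fst = 0 := hF.fac _ ⟨WalkingPair.left⟩
  have hm₂ : m ≫ F.snd = 𝟙 _ := hF.fac _ ⟨WalkingPair.right⟩
  have key : l (mabs a') ⊓ m (mabs b') = 1 := by
    refine ext_of_jointlyMono F.fst F.snd (fun W f g => BinaryFan.IsLimit.hom_ext hF) ?_ ?_
    · rw [hom_inf, ← comp_apply', ← comp_apply', hl₁, hm₁, hom_one]
      exact inf_eq_right.2 (one_le_mabs a')
    · rw [hom_inf, ← comp_apply', ← comp_apply', hl₂, hm₂, hom_one]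
      exact inf_eq_left.2 (one_le_mabs b')
  have := congrArg φ key
  rw [hom_inf, ← comp_apply', ← comp_apply', h₁, h₂, hom_one, hom_mabs, hom_mabs] at this
  exact this

/-- Internal equivalence relations with disjoint ideals commute. -/
theorem smithCommute_of_disjoint (h : ∀ x ∈ idealSet R, x ∈ idealSet S → x = 1) :
    R.SmithCommute S := by
  obtain ⟨Y, f, hf⟩ := isIdeal_idealSet R
  obtain ⟨Z, g, hg⟩ := isIdeal_idealSet S
  have hfR : ∀ r : R.obj, f (R.fst r) = f (R.snd r) := fun r => by
    have : R.fst r * (R.snd r)⁻¹ ∈ {x | f x = 1} := hf ▸ fst_mul_inv_snd_mem R r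
    rwa [Set.mem_ofPred_eq, hom_mul, hom_inv, mul_inv_eq_one] at this
  have hgS : ∀ s : S.obj, g (S.fst s) = g (S.snd s) := fun s => by
    have : S.fst s * (S.snd s)⁻¹ ∈ {x | g x = 1} := hg ▸ fst_mul_inv_snd_mem S s
    rwa [Set.mem_ofPred_eq, hom_mul, hom_inv, mul_inv_eq_one] at this
  -- The kernels I_R of `f` and I_S of `g` meet trivially, so identities in `X` may be checked after
  -- `f` and after `g`.
  have hinj : ∀ {x y : X}, f x = f y → g x = g y → x = y := fun {x y} h₁ h₂ => by
    refine mul_inv_eq_one.1 (h _ ?_ ?_)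
    · rw [hf, Set.mem_ofPred_eq, hom_mul, hom_inv, h₁, mul_inv_cancel]
    · rw [hg, Set.mem_ofPred_eq, hom_mul, hom_inv, h₂, mul_inv_cancel]
  let πR := fiberFst R.snd S.fst
  let πS := fiberSnd R.snd S.fst
  have hP : IsPullback πR πS R.snd S.fst := isPullback_fiberProduct R.snd S.fst
  let q : (fiberProduct R.snd S.fst).toLGrp → X := fun t =>
    R.fst (πR t) * (R.snd (πR t))⁻¹ * S.snd (πS t)
  have hqf : ∀ t, f (q t) = f (S.snd (πS t)) := fun t => by
    rw [hom_mul, hom_mul, hom_inv, hfR, mul_inv_cancel, one_mul]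
  have hw : ∀ t, R.snd (πR t) = S.fst (πS t) := fun t => t.2
  have hqg : ∀ t, g (q t) = g (R.fst (πR t)) := fun t => by
    rw [hom_mul, hom_mul, hom_inv, hw, hgS, inv_mul_cancel_right]
  let p : (fiberProduct R.snd S.fst).toLGrp ⟶ X := mkHom q
    (fun _ _ => hinj (by simp only [hqf, hom_mul]) (by simp only [hqg, hom_mul]))
    (fun _ _ => hinj (by simp only [hqf, hom_sup]) (by simp only [hqg, hom_sup]))
  set u := hP.lift (𝟙 R.obj) (R.snd ≫ S.rel.r) (by simp)
  set v := hP.lift (S.fst ≫ R.rel.r) (𝟙 S.obj) (by simp)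
  have hu₁ : ∀ r, πR (u r) = r := fun r =>
    congrArg (fun k : R.obj ⟶ R.obj => k r) (hP.lift_fst _ _ _)
  have hu₂ : ∀ r, πS (u r) = S.rel.r (R.snd r) := fun r =>
    congrArg (fun k : R.obj ⟶ S.obj => k r) (hP.lift_snd _ _ _)
  have hv₁ : ∀ s, πR (v s) = R.rel.r (S.fst s) := fun s =>
    congrArg (fun k : S.obj ⟶ R.obj => k s) (hP.lift_fst _ _ _)
  have hv₂ : ∀ s, πS (v s) = s := fun s =>
    congrArg (fun k : S.obj ⟶ S.obj => k s) (hP.lift_snd _ _ _)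
  refine ⟨_, πR, πS, hP, p, ⟨?_, ?_⟩, ?_⟩
  · ext r
    change R.fst (πR (u r)) * (R.snd (πR (u r)))⁻¹ * S.snd (πS (u r)) = R.fst r
    rw [hu₁, hu₂, snd_refl, inv_mul_cancel_right]
  · ext s
    change R.fst (πR (v s)) * (R.snd (πR (v s)))⁻¹ * S.snd (πS (v s)) = S.snd s
    rw [hv₁, hv₂, fst_refl, snd_refl, mul_inv_cancel, one_mul]
  · rintro p' ⟨h₁, h₂⟩
    have h₁' : ∀ r, p' (u r) = R.fst r := fun r => congrArg (fun k : R.obj ⟶ X => k r) h₁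
    have h₂' : ∀ s, p' (v s) = S.snd s := fun s => congrArg (fun k : S.obj ⟶ X => k s) h₂
    ext t
    -- With m = r₂ = s₁ the middle element, (r, s) = (r, δm)(δm, δm)⁻¹(δm, s). All factors come from
    -- `u` and `v`, so the two connector equations determine `p'`.
    have ht : t = u (πR t) * (u (R.rel.r (R.snd (πR t))))⁻¹ * v (πS t) := by
      apply fiberProduct_ext
      · change πR _ = πR _
        rw [hom_mul, hom_mul, hom_inv, hu₁, hu₁, hv₁, hw, inv_mul_cancel_right]
      · change πS _ = πS _
        rw [hom_mul, hom_mul, hom_inv, hu₂, hu₂, hv₂, snd_refl, mul_inv_cancel, one_mul]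
    conv_lhs => rw [ht]
    rw [hom_mul, hom_mul, hom_inv, h₁', h₁', h₂', fst_refl]
    rfl

theorem smithCommute_iff_huqCommute :
    R.SmithCommute S ↔ HuqCommute (idealOf R).incl (idealOf S).incl :=
  ⟨SmithCommute.huqCommute, fun h => smithCommute_of_disjoint fun _ hR hS =>
    eq_one_of_mabs_eq_one ((inf_idem _).symm.trans (HuqCommute.mabs_inf_mabs h hR hS))⟩

/-- Cooperation gives orthogonality of the two ideals; conversely an element of both is orthogonal
to itself, hence trivial. -/
theorem smithCommute_iff_subset_polar : R.SmithCommute S ↔ idealSet S ⊆ polar (idealSet R) := by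
  constructor
  · intro h x hx s hs
    rw [inf_comm]
    exact HuqCommute.mabs_inf_mabs (SmithCommute.huqCommute h) hs hx
  · intro h
    exact smithCommute_of_disjoint fun _ hR hS =>
      eq_one_of_mabs_eq_one ((inf_idem _).symm.trans (h hS _ hR))

theorem isCentralizer_iff {Z : InternalEqRel X} :
    R.IsCentralizer Z ↔ idealSet Z = polar (idealSet R) := by
  constructor
  · rintro ⟨h₁, h₂⟩
    obtain ⟨W, hW⟩ := exists_idealSet_eq (isIdeal_polar (idealSet_conj R))
    refine (smithCommute_iff_subset_polar.1 h₁).antisymm ?_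
    rw [← hW]
    exact le_iff_idealSet_subset.1 (h₂ (smithCommute_iff_subset_polar.2 hW.le))
  · intro h
    refine ⟨smithCommute_iff_subset_polar.2 h.le, fun S hS => ?_⟩
    rw [le_iff_idealSet_subset, h]
    exact smithCommute_iff_subset_polar.1 hS

end Commutators

end LGrp

theorem mainTheorem10 (X : LGrp.{u}) :
    ∃ φ : EqPoset X ≃o LGrp.Ideals X,
      (∀ R : InternalEqRel X, (φ R.toEq : Set X) = LGrp.idealSet R) ∧
      (∀ R S : InternalEqRel X,
        R.SmithCommute S ↔ HuqCommute (LGrp.idealOf R).incl (LGrp.idealOf S).incl) ∧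
      ∀ R : InternalEqRel X,
        (∃ Z : InternalEqRel X, R.IsCentralizer Z) ∧
        ∃ hI : LGrp.IsIdeal (LGrp.polar (LGrp.idealSet R)),
          ∀ Z : InternalEqRel X,
            R.IsCentralizer Z ↔ Z.toEq = φ.symm ⟨LGrp.polar (LGrp.idealSet R), hI⟩ := by
  refine ⟨LGrp.eqOrderIso X, fun R => rfl, fun R S => LGrp.smithCommute_iff_huqCommute,
    fun R => ?_⟩
  have hI := LGrp.isIdeal_polar (LGrp.idealSet_conj R)
  obtain ⟨Z, hZ⟩ := LGrp.exists_idealSet_eq hI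
  refine ⟨⟨Z, LGrp.isCentralizer_iff.2 hZ⟩, hI, fun Z => ?_⟩
  rw [LGrp.isCentralizer_iff, OrderIso.eq_symm_apply, Subtype.ext_iff]
  rfl
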